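/- Let $n$ be a natural number, let $H:\mathbb R^n\times\mathbb R\to\mathbb R$ and $a_1,\dots,a_n:\mathbb R^n\times\mathbb R\to\mathbb R$ be smooth functions of $(x,u)$, and equip $M=\mathbb R^n\times\mathbb R^2$, with coordinates $(x^1,\dots,x^n,u,r)$, with the gyratonic pp-wave metric $$ds^2=\delta_{ij}\,dx^i dx^j-2\,du\,dr+H(x,u)\,du^2+2a_i(x,u)\,du\,dx^i .$$ Suppose that the spatial gradient $X=(\partial_{x^k}H)_{k}$ and the $u$-derivative $X=(\partial_u a_k)_{k}$ both grow at most linearly along finite times, that is, in each of the two cases for every $T>0$ there are a point $\bar x\in\mathbb R^n$ and constants $A_T,C_T>0$ such that $$|X(x,s)|\le A_T\,|x-\bar x|+C_T\qquad\text{for all }x\in\mathbb R^n,\ s\in[-T,T],$$ where $|\cdot|$ is the Euclidean norm. Then $(M,g)$ is geodesically complete: every geodesic of the metric $g=ds^2$ (of any causal character) defined on an open interval extends to a geodesic defined on all of $\mathbb R$. -/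

import Mathlib

open scoped ContDiff

noncomputable section

/-! ### Geodesics of a pseudo-Riemannian metric in global coordinates

A metric on the manifold `ℝ^ι` (with its global chart) is given by the matrix `g p μ ν = g_{μν}(p)`
of its components. -/

section Geodesics

variable {ι : Type*} [Fintype ι] [DecidableEq ι]

/-- The partial derivative `∂_μ f` at `p` of a real function on `ℝ^ι`. -/
def partialDeriv (μ : ι) (f : (ι → ℝ) → ℝ) (p : ι → ℝ) : ℝ :=
  fderiv ℝ f p (Pi.single μ 1)

/-- The Christoffel symbols of the Levi-Civita connection of `g`:
`Γ^μ_{νρ} = ½ g^{μσ} (∂_ν g_{σρ} + ∂_ρ g_{σν} - ∂_σ g_{νρ})`. -/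
def christoffel (g : (ι → ℝ) → Matrix ι ι ℝ) (p : ι → ℝ) (μ ν ρ : ι) : ℝ :=
  (1 / 2) * ∑ σ, (g p)⁻¹ μ σ *
    (partialDeriv ν (fun q => g q σ ρ) p + partialDeriv ρ (fun q => g q σ ν) p
      - partialDeriv σ (fun q => g q ν ρ) p)

/-- `γ` is a geodesic of `g` on the open set of parameters `I`:
a `C²` curve with `γ''^μ + Γ^μ_{νρ}(γ) γ'^ν γ'^ρ = 0`. -/
def IsGeodesicOn (g : (ι → ℝ) → Matrix ι ι ℝ) (γ : ℝ → ι → ℝ) (I : Set ℝ) : Prop :=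
  ContDiffOn ℝ 2 γ I ∧
    ∀ s ∈ I, ∀ μ, deriv (deriv γ) s μ +
      ∑ ν, ∑ ρ, christoffel g (γ s) μ ν ρ * deriv γ s ν * deriv γ s ρ = 0

/-- Geodesic completeness (of all geodesics, whatever their causal character): every geodesic
defined on an open interval `I` extends to a geodesic defined on the whole real line. -/
def GeodesicallyComplete (g : (ι → ℝ) → Matrix ι ι ℝ) : Prop :=
  ∀ (I : Set ℝ) (γ : ℝ → ι → ℝ), IsOpen I → I.OrdConnected → IsGeodesicOn g γ I →
    ∃ γ' : ℝ → ι → ℝ, IsGeodesicOn g γ' Set.univ ∧ Set.EqOn γ' γ I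

end Geodesics

/-! ### Gyratonic pp-waves with wave surface `ℝⁿ`

Points of `M = ℝⁿ × ℝ²` are described by their coordinates `(x¹, …, xⁿ, u, r)`, indexed by
`Fin n ⊕ Fin 2`: `Sum.inl i` is the index of `xⁱ`, `Sum.inr 0` that of `u`, `Sum.inr 1` that
of `r`. -/

/-- The spatial coordinates `x ∈ ℝⁿ` of a point. -/
def spatialPart {n : ℕ} (p : Fin n ⊕ Fin 2 → ℝ) : EuclideanSpace ℝ (Fin n) :=
  WithLp.toLp 2 (fun i => p (Sum.inl i))

/-- The metric `δ_{ij} dxⁱ dxʲ - 2 du dr + H(x,u) du² + 2 a_i(x,u) du dxⁱ`. -/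
def gyratonMetric {n : ℕ} (H : EuclideanSpace ℝ (Fin n) → ℝ → ℝ)
    (a : EuclideanSpace ℝ (Fin n) → ℝ → EuclideanSpace ℝ (Fin n))
    (p : Fin n ⊕ Fin 2 → ℝ) : Matrix (Fin n ⊕ Fin 2) (Fin n ⊕ Fin 2) ℝ :=
  let x := spatialPart p
  let u := p (Sum.inr 0)
  Matrix.fromBlocks
    1                                          (Matrix.of fun i => ![a x u i, 0])
    (Matrix.of fun i => ![a x u i, 0]).transpose !![H x u, -1; -1, 0]

/-- A (spatial, `u`-dependent) vector or covector field `X` on flat `ℝⁿ` grows at most linearly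
along finite times. -/
def GrowsAtMostLinearly {n : ℕ}
    (X : EuclideanSpace ℝ (Fin n) → ℝ → EuclideanSpace ℝ (Fin n)) : Prop :=
  ∀ T : ℝ, 0 < T → ∃ (x₀ : EuclideanSpace ℝ (Fin n)) (A C : ℝ), 0 < A ∧ 0 < C ∧
    ∀ x, ∀ s ∈ Set.Icc (-T) T, ‖X x s‖ ≤ A * dist x x₀ + C

end

/-!
The metric does not depend on `r`, so the momentum conjugate to `r`, which is `-u'`, is constant
along a geodesic: `u` is an affine function of the parameter, with some slope `α`. The spatial components of the geodesic equation then
form a second order system for `x` alone,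
`x'' = G(u, x, x')`, with `G = α (Da)ᵀ x' - α Da (x', α) + ½ α² ∇H` (`spatialForce`),
and the remaining component gives `r''` as a smooth function of `(u, x, x')` (`transverseForce`),
so that `r` is found by two integrations. This decoupling is `gyraton_geodesicEquation_iff`.

No growth condition is imposed on the spatial derivatives of `a`. They enter `G` only through the
magnetic term `α ((Da)ᵀ - Da) x'`, which is skew-symmetric in `x'` and does no work:
`⟪x', G⟫ = ½ α² ⟪∇H, x'⟫ - α² ⟪∂ᵤa, x'⟫` (`inner_self_spatialForce`). By the growth hypotheses
`|⟪x', G⟫| ≤ K (1 + |x|² + |x'|²)` locally uniformly in time, and Grönwall's inequality bounds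
`1 + |x|² + |x'|²` on bounded intervals. That such a bound on the radial part of a `C¹` vector field
makes all its solutions global is `exists_forall_hasDerivAt_of_radial_bound`. The field is
multiplied by a cutoff function with values in `[0, 1]`; the truncated field satisfies the same
radial bound, so the a priori estimate applies to its solutions directly, and a sufficiently large
cutoff radius is never reached.

Hence there is a global geodesic with any prescribed initial data, and uniqueness for `C¹` systems,
applied in turn to `u`, to `x` and to `r`, identifies it with the given geodesic on its interval.
-/

/-! ### Global solutions of ordinary differential equations -/

open Set Metric Function in
/-- Two solutions of an ordinary differential equation with `C¹` right-hand side which agree at one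
point of an interval agree on it. No global Lipschitz bound is needed: on a compact subinterval both
solutions stay in a compact set, where the vector field is Lipschitz. -/
theorem eqOn_of_hasDerivAt_of_contDiff {E : Type*} [NormedAddCommGroup E] [NormedSpace ℝ E]
    {F : ℝ → E → E} (hF : ContDiff ℝ 1 (uncurry F)) {I : Set ℝ} (hI : I.OrdConnected)
    {f g : ℝ → E} (hf : ∀ t ∈ I, HasDerivAt f (F t (f t)) t)
    (hg : ∀ t ∈ I, HasDerivAt g (F t (g t)) t) {t₀ : ℝ} (ht₀ : t₀ ∈ I) (h : f t₀ = g t₀) :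
    EqOn f g I := by
  have key : ∀ a b, Icc a b ⊆ I → ContinuousOn f (Icc a b) ∧ ContinuousOn g (Icc a b) ∧
      ∃ (S : Set E) (K : NNReal), (∀ t ∈ Icc a b, LipschitzOnWith K (F t) S) ∧
        (∀ t ∈ Icc a b, f t ∈ S) ∧ (∀ t ∈ Icc a b, g t ∈ S) := by
    intro a b hab
    have cf : ContinuousOn f (Icc a b) := HasDerivAt.continuousOn fun t ht => hf t (hab ht)
    have cg : ContinuousOn g (Icc a b) := HasDerivAt.continuousOn fun t ht => hg t (hab ht)
    refine ⟨cf, cg, f '' Icc a b ∪ g '' Icc a b, ?_⟩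
    have hc : IsCompact (f '' Icc a b ∪ g '' Icc a b) :=
      (isCompact_Icc.image_of_continuousOn cf).union (isCompact_Icc.image_of_continuousOn cg)
    obtain ⟨K, hK⟩ := LocallyLipschitzOn.exists_lipschitzOnWith_of_compact
      ((isCompact_Icc (a := a) (b := b)).prod hc) hF.locallyLipschitz.locallyLipschitzOn
    refine ⟨K, fun t ht x hx y hy => ?_, fun t ht => Or.inl ⟨t, ht, rfl⟩,
      fun t ht => Or.inr ⟨t, ht, rfl⟩⟩
    simpa [Prod.edist_eq] using hK (x := (t, x)) ⟨ht, hx⟩ (y := (t, y)) ⟨ht, hy⟩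
  intro t ht
  rcases le_total t t₀ with htt | htt
  · have hsub : Icc t t₀ ⊆ I := hI.out ht ht₀
    obtain ⟨cf, cg, S, K, hK, hfS, hgS⟩ := key t t₀ hsub
    exact ODE_solution_unique_of_mem_Icc_left (s := fun _ => S)
      (fun s hs => hK s (Ioc_subset_Icc_self hs)) cf
      (fun s hs => (hf s (hsub (Ioc_subset_Icc_self hs))).hasDerivWithinAt)
      (fun s hs => hfS s (Ioc_subset_Icc_self hs)) cg
      (fun s hs => (hg s (hsub (Ioc_subset_Icc_self hs))).hasDerivWithinAt)
      (fun s hs => hgS s (Ioc_subset_Icc_self hs)) h ⟨le_rfl, htt⟩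
  · have hsub : Icc t₀ t ⊆ I := hI.out ht₀ ht
    obtain ⟨cf, cg, S, K, hK, hfS, hgS⟩ := key t₀ t hsub
    exact ODE_solution_unique_of_mem_Icc_right (s := fun _ => S)
      (fun s hs => hK s (Ico_subset_Icc_self hs)) cf
      (fun s hs => (hf s (hsub (Ico_subset_Icc_self hs))).hasDerivWithinAt)
      (fun s hs => hfS s (Ico_subset_Icc_self hs)) cg
      (fun s hs => (hg s (hsub (Ico_subset_Icc_self hs))).hasDerivWithinAt)
      (fun s hs => hgS s (Ico_subset_Icc_self hs)) h ⟨htt, le_rfl⟩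

/-- Grönwall's estimate, in both time directions. -/
theorem le_mul_exp_of_abs_deriv_le {h h' : ℝ → ℝ} {K t₀ T : ℝ}
    (hd : ∀ t ∈ Set.Icc (t₀ - T) (t₀ + T),
      HasDerivWithinAt h (h' t) (Set.Icc (t₀ - T) (t₀ + T)) t)
    (hb : ∀ t ∈ Set.Icc (t₀ - T) (t₀ + T), |h' t| ≤ K * h t)
    {t : ℝ} (ht : t ∈ Set.Icc (t₀ - T) (t₀ + T)) : h t ≤ h t₀ * Real.exp (K * |t - t₀|) := by
  have hint : interior (Set.Icc (t₀ - T) (t₀ + T)) ⊆ Set.Icc (t₀ - T) (t₀ + T) := interior_subset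
  have h0 : t₀ ∈ Set.Icc (t₀ - T) (t₀ + T) := by
    constructor <;> linarith [ht.1, ht.2]
  have hE : ∀ c s : ℝ, HasDerivAt (fun s => Real.exp (c * (s - t₀)))
      (Real.exp (c * (s - t₀)) * c) s := fun c s => by
    simpa using (((hasDerivAt_id s).sub_const t₀).const_mul c).exp
  have hD : ∀ c, ∀ s ∈ Set.Icc (t₀ - T) (t₀ + T),
      HasDerivWithinAt (fun s => h s * Real.exp (c * (s - t₀)))
        (h' s * Real.exp (c * (s - t₀)) + h s * (Real.exp (c * (s - t₀)) * c))
        (Set.Icc (t₀ - T) (t₀ + T)) s := fun c s hs => (hd s hs).mul (hE c s).hasDerivWithinAt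
  have hmono : MonotoneOn (fun s => h s * Real.exp (K * (s - t₀)))
      (Set.Icc (t₀ - T) (t₀ + T)) := by
    refine monotoneOn_of_hasDerivWithinAt_nonneg (convex_Icc _ _)
      (fun s hs => (hD K s hs).continuousWithinAt)
      (fun s hs => (hD K s (hint hs)).mono hint) fun s hs => ?_
    have := hb s (hint hs)
    have h2 := neg_abs_le (h' s)
    have : 0 ≤ (h' s + K * h s) * Real.exp (K * (s - t₀)) :=
      mul_nonneg (by linarith) (Real.exp_pos _).le
    linarith
  have hanti : AntitoneOn (fun s => h s * Real.exp (-K * (s - t₀)))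
      (Set.Icc (t₀ - T) (t₀ + T)) := by
    refine antitoneOn_of_hasDerivWithinAt_nonpos (convex_Icc _ _)
      (fun s hs => (hD (-K) s hs).continuousWithinAt)
      (fun s hs => (hD (-K) s (hint hs)).mono hint) fun s hs => ?_
    have := hb s (hint hs)
    have h2 := le_abs_self (h' s)
    have : 0 ≤ (K * h s - h' s) * Real.exp (-K * (s - t₀)) :=
      mul_nonneg (by linarith) (Real.exp_pos _).le
    linarith
  rcases le_total t t₀ with htt | htt
  · have := hmono ht h0 htt
    simp only [sub_self, mul_zero, Real.exp_zero, mul_one] at this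
    rw [abs_of_nonpos (by linarith)]
    calc h t = h t * Real.exp (K * (t - t₀)) * Real.exp (K * -(t - t₀)) := by
          rw [mul_assoc, ← Real.exp_add, ← mul_add, add_neg_cancel, mul_zero, Real.exp_zero,
            mul_one]
      _ ≤ _ := by gcongr
  · have := hanti h0 ht htt
    simp only [sub_self, mul_zero, Real.exp_zero, mul_one] at this
    rw [abs_of_nonneg (by linarith)]
    calc h t = h t * Real.exp (-K * (t - t₀)) * Real.exp (K * (t - t₀)) := by
          rw [mul_assoc, ← Real.exp_add]; simp
      _ ≤ _ := by gcongr

open Set Metric Function in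
/-- The solutions of a bounded `C¹` vector field exist on every compact interval. -/
theorem exists_hasDerivWithinAt_Icc_of_bounded {E : Type*} [NormedAddCommGroup E]
    [NormedSpace ℝ E] [ProperSpace E] {F : ℝ → E → E}
    (hF : ContDiff ℝ 1 (uncurry F)) {t₀ T : ℝ} (hT : 0 ≤ T) {L : NNReal}
    (hL : ∀ t ∈ Icc (t₀ - T) (t₀ + T), ∀ y, ‖F t y‖ ≤ L) (y₀ : E) :
    ∃ y : ℝ → E, y t₀ = y₀ ∧ ∀ t ∈ Icc (t₀ - T) (t₀ + T),
      HasDerivWithinAt y (F t (y t)) (Icc (t₀ - T) (t₀ + T)) t := by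
  -- A solution moves by at most `L * T`, so Picard-Lindelöf on the ball of that radius applies.
  obtain ⟨K, hK⟩ := LocallyLipschitzOn.exists_lipschitzOnWith_of_compact
    ((isCompact_Icc (a := t₀ - T) (b := t₀ + T)).prod
      (isCompact_closedBall y₀ ((L * T.toNNReal : NNReal) : ℝ)))
    hF.locallyLipschitz.locallyLipschitzOn
  have hPL : IsPicardLindelof F (tmin := t₀ - T) (tmax := t₀ + T)
      ⟨t₀, by constructor <;> linarith⟩ y₀ (L * T.toNNReal) 0 L K := by
    refine ⟨fun t ht x hx y hy => ?_, fun x _ => ?_, fun t ht x _ => hL t ht x, ?_⟩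
    · simpa [Prod.edist_eq] using hK (x := (t, x)) ⟨ht, hx⟩ (y := (t, y)) ⟨ht, hy⟩
    · exact (hF.continuous.comp (Continuous.prodMk_left x)).continuousOn
    · simp [hT]
  exact hPL.exists_eq_forall_mem_Icc_hasDerivWithinAt₀

open Set Metric Function in
open scoped RealInnerProductSpace in
/-- If the radial part of a `C¹` vector field satisfies `|⟪y, F t y⟫| ≤ K (1 + ‖y‖²)` for times in a
compact interval, then its solutions exist on the whole interval. -/
theorem exists_hasDerivWithinAt_Icc_of_radial_bound {E : Type*} [NormedAddCommGroup E]
    [InnerProductSpace ℝ E] [FiniteDimensional ℝ E] {F : ℝ → E → E}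
    (hF : ContDiff ℝ 1 (uncurry F)) {t₀ T K : ℝ} (hT : 0 ≤ T)
    (hK : ∀ t ∈ Icc (t₀ - T) (t₀ + T), ∀ y, |⟪y, F t y⟫| ≤ K * (1 + ‖y‖ ^ 2)) (y₀ : E) :
    ∃ y : ℝ → E, y t₀ = y₀ ∧ ∀ t ∈ Icc (t₀ - T) (t₀ + T),
      HasDerivWithinAt y (F t (y t)) (Icc (t₀ - T) (t₀ + T)) t := by
  have hK0 : 0 ≤ K := by
    have := hK t₀ (by constructor <;> linarith) 0
    simpa using (abs_nonneg _).trans this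
  -- `R` is the bound that Grönwall's inequality gives for `1 + ‖y‖²`; multiplying `F` by a cutoff
  -- function with values in `[0, 1]` does not spoil the radial bound, so `R` serves for the
  -- truncated field as well.
  set R : ℝ := (1 + ‖y₀‖ ^ 2) * Real.exp (2 * K * T) with hR
  have hRpos : 0 < R := by positivity
  let χ : ContDiffBump (0 : E) := ⟨R, R + 1, hRpos, by linarith⟩
  have hχF : ContDiff ℝ 1 (uncurry fun t y => χ y • F t y) :=
    (χ.contDiff.comp contDiff_snd).smul hF
  obtain ⟨L, hL⟩ := ((isCompact_Icc (a := t₀ - T) (b := t₀ + T)).prod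
      (isCompact_closedBall (0 : E) (R + 1))).exists_bound_of_continuousOn
      hF.continuous.continuousOn
  have hbd : ∀ t ∈ Icc (t₀ - T) (t₀ + T), ∀ y, ‖χ y • F t y‖ ≤ L.toNNReal := by
    intro t ht y
    by_cases hy : y ∈ closedBall (0 : E) (R + 1)
    · rw [norm_smul, Real.norm_of_nonneg χ.nonneg]
      calc χ y * ‖F t y‖ ≤ 1 * ‖F t y‖ := by gcongr; exact χ.le_one
        _ ≤ L := by simpa using hL (t, y) ⟨ht, hy⟩
        _ ≤ _ := Real.le_coe_toNNReal L
    · rw [χ.zero_of_le_dist (by rw [mem_closedBall, not_le] at hy; exact hy.le)]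
      simp
  obtain ⟨y, hy0, hy⟩ := exists_hasDerivWithinAt_Icc_of_bounded hχF hT hbd y₀
  refine ⟨y, hy0, fun t ht => ?_⟩
  have hbound : 1 + ‖y t‖ ^ 2 ≤ R := by
    have hgr := le_mul_exp_of_abs_deriv_le (h := fun t => 1 + ‖y t‖ ^ 2)
      (h' := fun t => 2 * ⟪y t, χ (y t) • F t (y t)⟫) (K := 2 * K) (t₀ := t₀) (T := T)
      (fun t ht => (hy t ht).norm_sq.const_add 1) (fun t ht => by
        rw [real_inner_smul_right, abs_mul, abs_mul, abs_two, abs_of_nonneg χ.nonneg]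
        have : χ (y t) * |⟪y t, F t (y t)⟫| ≤ K * (1 + ‖y t‖ ^ 2) := calc
          χ (y t) * |⟪y t, F t (y t)⟫| ≤ 1 * |⟪y t, F t (y t)⟫| := by
              gcongr; exact χ.le_one
          _ ≤ _ := by simpa using hK t ht (y t)
        linarith) ht
    simp only [hy0] at hgr
    refine hgr.trans ?_
    rw [hR]
    gcongr
    rw [abs_le]; constructor <;> linarith [ht.1, ht.2]
  have hχ1 : χ (y t) = 1 := by
    refine χ.one_of_mem_closedBall ?_
    rw [mem_closedBall, dist_zero_right]
    change ‖y t‖ ≤ R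
    nlinarith [sq_nonneg (‖y t‖ - 1)]
  simpa [hχ1] using hy t ht

open Set Metric Function in
open scoped RealInnerProductSpace in
/-- A `C¹` vector field whose radial part satisfies `|⟪y, F t y⟫| ≤ K (1 + ‖y‖²)`, with `K` locally
uniform in time, has global solutions. -/
theorem exists_forall_hasDerivAt_of_radial_bound {E : Type*} [NormedAddCommGroup E]
    [InnerProductSpace ℝ E] [FiniteDimensional ℝ E] {F : ℝ → E → E}
    (hF : ContDiff ℝ 1 (uncurry F)) (t₀ : ℝ)
    (hK : ∀ T > 0, ∃ K, ∀ t ∈ Icc (t₀ - T) (t₀ + T), ∀ y, |⟪y, F t y⟫| ≤ K * (1 + ‖y‖ ^ 2))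
    (y₀ : E) :
    ∃ y : ℝ → E, y t₀ = y₀ ∧ ∀ t, HasDerivAt y (F t (y t)) t := by
  have hex : ∀ T > 0, ∃ y : ℝ → E, y t₀ = y₀ ∧ ∀ t ∈ Ioo (t₀ - T) (t₀ + T),
      HasDerivAt y (F t (y t)) t := by
    intro T hT
    obtain ⟨K, hK⟩ := hK T hT
    obtain ⟨y, hy0, hy⟩ := exists_hasDerivWithinAt_Icc_of_radial_bound hF hT.le hK y₀
    exact ⟨y, hy0, fun t ht => (hy t (Ioo_subset_Icc_self ht)).hasDerivAt
      (Icc_mem_nhds ht.1 ht.2)⟩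
  choose! y hy0 hy using hex
  have hmem : ∀ T > 0, t₀ ∈ Ioo (t₀ - T) (t₀ + T) := fun T hT => by
    constructor <;> linarith
  have huniq : ∀ S T, 0 < S → S ≤ T → EqOn (y S) (y T) (Ioo (t₀ - S) (t₀ + S)) := by
    intro S T hS hST
    refine eqOn_of_hasDerivAt_of_contDiff hF ordConnected_Ioo (hy S hS) (fun t ht => ?_)
      (hmem S hS) ((hy0 S hS).trans (hy0 T (hS.trans_le hST)).symm)
    exact hy T (hS.trans_le hST) t ⟨by linarith [ht.1], by linarith [ht.2]⟩
  have hglue : ∀ T > 0, ∀ t ∈ Ioo (t₀ - T) (t₀ + T), y (|t - t₀| + 1) t = y T t := by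
    intro T hT t ht
    have h1 : t ∈ Ioo (t₀ - (|t - t₀| + 1)) (t₀ + (|t - t₀| + 1)) := by
      constructor <;> linarith [le_abs_self (t - t₀), neg_abs_le (t - t₀)]
    rcases le_total (|t - t₀| + 1) T with h | h
    · exact huniq _ _ (by positivity) h h1
    · exact (huniq _ _ hT h ht).symm
  -- The solutions on the intervals of radius `T` are compatible; near `t` the glued curve is the
  -- one of radius `|t - t₀| + 1`.
  refine ⟨fun t => y (|t - t₀| + 1) t, by simp [hy0], fun t => ?_⟩
  have hT : 0 < |t - t₀| + 1 := by positivity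
  have h1 : t ∈ Ioo (t₀ - (|t - t₀| + 1)) (t₀ + (|t - t₀| + 1)) := by
    constructor <;> linarith [le_abs_self (t - t₀), neg_abs_le (t - t₀)]
  refine (hy _ hT t h1).congr_of_eventuallyEq ?_
  filter_upwards [isOpen_Ioo.mem_nhds h1] with s hs using hglue _ hT s hs

open Set Function in
open scoped RealInnerProductSpace in
/-- A second order equation `x'' = G(t, x, x')` has global solutions if the power `⟪x', G⟫` of the
force is bounded by `K (1 + ‖x‖² + ‖x'‖²)`, with `K` locally uniform in time. -/
theorem exists_forall_hasDerivAt_second_order {E : Type*} [NormedAddCommGroup E]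
    [InnerProductSpace ℝ E] [FiniteDimensional ℝ E] {G : ℝ → E → E → E}
    (hG : ContDiff ℝ 1 fun q : ℝ × E × E => G q.1 q.2.1 q.2.2) (t₀ : ℝ)
    (hK : ∀ T > 0, ∃ K, ∀ t ∈ Icc (t₀ - T) (t₀ + T), ∀ x v,
      |⟪v, G t x v⟫| ≤ K * (1 + ‖x‖ ^ 2 + ‖v‖ ^ 2))
    (x₀ v₀ : E) :
    ∃ x v : ℝ → E, x t₀ = x₀ ∧ v t₀ = v₀ ∧
      (∀ t, HasDerivAt x (v t) t) ∧ ∀ t, HasDerivAt v (G t (x t) (v t)) t := by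
  -- The phase space carries the Euclidean norm, not the sup norm of the product.
  let e := WithLp.prodContinuousLinearEquiv 2 ℝ E E
  have hF : ContDiff ℝ 1 (uncurry fun (t : ℝ) (y : WithLp 2 (E × E)) =>
      e.symm ((e y).2, G t (e y).1 (e y).2)) := by
    have h : ContDiff ℝ 1 fun q : ℝ × WithLp 2 (E × E) => e q.2 :=
      e.contDiff.comp contDiff_snd
    exact e.symm.contDiff.comp (h.snd.prodMk (hG.comp (contDiff_fst.prodMk h)))
  obtain ⟨y, hy0, hy⟩ := exists_forall_hasDerivAt_of_radial_bound hF t₀ (fun T hT => by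
    obtain ⟨K, hK⟩ := hK T hT
    refine ⟨1 + K, fun t ht y => ?_⟩
    have h1 := hK t ht (e y).1 (e y).2
    have h2 := abs_real_inner_le_norm (e y).1 (e y).2
    have h3 := two_mul_le_add_sq ‖(e y).1‖ ‖(e y).2‖
    have h4 : ⟪y, e.symm ((e y).2, G t (e y).1 (e y).2)⟫
        = ⟪(e y).1, (e y).2⟫ + ⟪(e y).2, G t (e y).1 (e y).2⟫ :=
      WithLp.prod_inner_apply _ _
    have h5 : ‖y‖ ^ 2 = ‖(e y).1‖ ^ 2 + ‖(e y).2‖ ^ 2 := WithLp.prod_norm_sq_eq_of_L2 y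
    rw [h4, h5]
    refine (abs_add_le _ _).trans ?_
    nlinarith [sq_nonneg ‖(e y).1‖, sq_nonneg ‖(e y).2‖]) (e.symm (x₀, v₀))
  have hy' : ∀ t, HasDerivAt (fun t => e (y t)) ((e (y t)).2, G t (e (y t)).1 (e (y t)).2) t :=
    fun t => e.hasFDerivAt.comp_hasDerivAt t (hy t)
  exact ⟨fun t => (e (y t)).1, fun t => (e (y t)).2, by simp [hy0], by simp [hy0],
    fun t => (hy' t).fst, fun t => (hy' t).snd⟩

open Set Function in
theorem eqOn_of_hasDerivAt_second_order {E : Type*} [NormedAddCommGroup E]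
    [NormedSpace ℝ E] {G : ℝ → E → E → E}
    (hG : ContDiff ℝ 1 fun q : ℝ × E × E => G q.1 q.2.1 q.2.2)
    {I : Set ℝ} (hI : I.OrdConnected) {x v y w : ℝ → E}
    (hx : ∀ t ∈ I, HasDerivAt x (v t) t) (hv : ∀ t ∈ I, HasDerivAt v (G t (x t) (v t)) t)
    (hy : ∀ t ∈ I, HasDerivAt y (w t) t) (hw : ∀ t ∈ I, HasDerivAt w (G t (y t) (w t)) t)
    {t₀ : ℝ} (ht₀ : t₀ ∈ I) (h0 : x t₀ = y t₀) (h1 : v t₀ = w t₀) :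
    EqOn x y I ∧ EqOn v w I := by
  have hF : ContDiff ℝ 1 (uncurry fun (t : ℝ) (y : E × E) => (y.2, G t y.1 y.2)) :=
    (contDiff_snd.comp contDiff_snd).prodMk hG
  have h := eqOn_of_hasDerivAt_of_contDiff hF hI (f := fun t => (x t, v t))
    (g := fun t => (y t, w t)) (fun t ht => (hx t ht).prodMk (hv t ht))
    (fun t ht => (hy t ht).prodMk (hw t ht)) ht₀ (by simp [h0, h1])
  exact ⟨fun t ht => congrArg Prod.fst (h ht), fun t ht => congrArg Prod.snd (h ht)⟩

theorem contDiff_of_hasDerivAt {E : Type*} [NormedAddCommGroup E] [NormedSpace ℝ E]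
    {f f' : ℝ → E} {n : ℕ} (h : ∀ t, HasDerivAt f (f' t) t) (hf' : ContDiff ℝ n f') :
    ContDiff ℝ (n + 1) f := by
  rw [contDiff_succ_iff_deriv]
  refine ⟨fun t => (h t).differentiableAt, by simp, ?_⟩
  rwa [show deriv f = f' from funext fun t => (h t).deriv]

theorem exists_antideriv {f : ℝ → ℝ} (hf : Continuous f) (t₀ y₀ : ℝ) :
    ∃ y : ℝ → ℝ, y t₀ = y₀ ∧ ∀ t, HasDerivAt y (f t) t :=
  ⟨fun t => y₀ + ∫ s in t₀..t, f s, by simp, fun t =>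
    (intervalIntegral.integral_hasDerivAt_right (hf.intervalIntegrable _ _)
      (hf.stronglyMeasurableAtFilter _ _) hf.continuousAt).const_add _⟩

/-! ### The geodesic equation with a lowered index -/

section GeodesicEquation

variable {ι : Type*} [Fintype ι] [DecidableEq ι]

theorem fderiv_apply_eq_sum_partialDeriv (f : (ι → ℝ) → ℝ) (p v : ι → ℝ) :
    fderiv ℝ f p v = ∑ μ, v μ * partialDeriv μ f p := by
  conv_lhs => rw [pi_eq_sum_univ' v]
  simp [partialDeriv, map_sum]

/-- The quadratic term of the geodesic equation with its index lowered:
`L_σ(v) = (∂_ν g_{σρ} - ½ ∂_σ g_{νρ}) v^ν v^ρ`, that is, `g_{σμ} Γ^μ_{νρ} v^ν v^ρ`. -/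
noncomputable def loweredGeodesicForm (g : (ι → ℝ) → Matrix ι ι ℝ) (p v : ι → ℝ) (σ : ι) : ℝ :=
  ∑ ρ, fderiv ℝ (fun q => g q σ ρ) p v * v ρ
    - (1 / 2) * ∑ ν, ∑ ρ, partialDeriv σ (fun q => g q ν ρ) p * v ν * v ρ

theorem sum_christoffel (g : (ι → ℝ) → Matrix ι ι ℝ) (p v : ι → ℝ) (μ : ι) :
    ∑ ν, ∑ ρ, christoffel g p μ ν ρ * v ν * v ρ
      = ((g p)⁻¹.mulVec (loweredGeodesicForm g p v)) μ := by
  have h : ∀ σ, loweredGeodesicForm g p v σ = ∑ ν, ∑ ρ, (1 / 2) *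
      (partialDeriv ν (fun q => g q σ ρ) p + partialDeriv ρ (fun q => g q σ ν) p
        - partialDeriv σ (fun q => g q ν ρ) p) * v ν * v ρ := by
    intro σ
    have h1 : ∑ ρ, fderiv ℝ (fun q => g q σ ρ) p v * v ρ
        = ∑ ν, ∑ ρ, partialDeriv ν (fun q => g q σ ρ) p * v ν * v ρ := by
      rw [Finset.sum_comm]
      refine Finset.sum_congr rfl fun ρ _ => ?_
      rw [fderiv_apply_eq_sum_partialDeriv, Finset.sum_mul]
      exact Finset.sum_congr rfl fun ν _ => by ring
    have h2 : ∑ ρ, fderiv ℝ (fun q => g q σ ρ) p v * v ρ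
        = ∑ ν, ∑ ρ, partialDeriv ρ (fun q => g q σ ν) p * v ν * v ρ := by
      rw [h1, Finset.sum_comm]
      exact Finset.sum_congr rfl fun ρ _ => Finset.sum_congr rfl fun ν _ => by ring
    have h3 : ∑ ρ, fderiv ℝ (fun q => g q σ ρ) p v * v ρ
        = (1 / 2) * ∑ ρ, fderiv ℝ (fun q => g q σ ρ) p v * v ρ
          + (1 / 2) * ∑ ρ, fderiv ℝ (fun q => g q σ ρ) p v * v ρ := by ring
    rw [loweredGeodesicForm, h3]
    nth_rewrite 1 [h1]
    rw [h2]
    simp only [Finset.mul_sum, ← Finset.sum_add_distrib, ← Finset.sum_sub_distrib]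
    exact Finset.sum_congr rfl fun ν _ => Finset.sum_congr rfl fun ρ _ => by ring
  simp only [Matrix.mulVec, dotProduct, h, christoffel, Finset.mul_sum, Finset.sum_mul]
  rw [Finset.sum_comm' (t' := Finset.univ) (s' := fun _ => Finset.univ) (by simp)]
  conv_rhs => rw [Finset.sum_comm]
  rw [Finset.sum_comm]
  refine Finset.sum_congr rfl fun ν _ => ?_
  conv_rhs => rw [Finset.sum_comm]
  exact Finset.sum_congr rfl fun ρ _ => Finset.sum_congr rfl fun σ _ => by ring

/-- Lowering the index of the geodesic equation: `w + Γ(v, v) = 0` if and only if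
`g w + L(v) = 0`. This spares the computation of the inverse of `g`. -/
theorem geodesicEquation_iff_lowered {g : (ι → ℝ) → Matrix ι ι ℝ} {p : ι → ℝ} (hg : IsUnit (g p))
    (v w : ι → ℝ) :
    (∀ μ, w μ + ∑ ν, ∑ ρ, christoffel g p μ ν ρ * v ν * v ρ = 0) ↔
      ∀ σ, (g p).mulVec w σ + loweredGeodesicForm g p v σ = 0 := by
  have hdet : IsUnit (g p).det := (Matrix.isUnit_iff_isUnit_det _).1 hg
  simp only [sum_christoffel]
  have h1 : (∀ μ, w μ + ((g p)⁻¹.mulVec (loweredGeodesicForm g p v)) μ = 0) ↔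
      w + (g p)⁻¹.mulVec (loweredGeodesicForm g p v) = 0 := by simp [funext_iff]
  have h2 : (∀ σ, (g p).mulVec w σ + loweredGeodesicForm g p v σ = 0) ↔
      (g p).mulVec w + loweredGeodesicForm g p v = 0 := by simp [funext_iff]
  rw [h1, h2]
  constructor <;> intro h
  · have := congrArg (g p).mulVec h
    simpa [Matrix.mulVec_add, Matrix.mulVec_mulVec, Matrix.mul_nonsing_inv _ hdet] using this
  · have := congrArg (g p)⁻¹.mulVec h
    simpa [Matrix.mulVec_add, Matrix.mulVec_mulVec, Matrix.nonsing_inv_mul _ hdet] using this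

theorem isGeodesicOn_const (g : (ι → ℝ) → Matrix ι ι ℝ) (p : ι → ℝ) (I : Set ℝ) :
    IsGeodesicOn g (fun _ => p) I :=
  ⟨contDiffOn_const, by simp⟩

theorem IsGeodesicOn.hasDerivAt {g : (ι → ℝ) → Matrix ι ι ℝ} {γ : ℝ → ι → ℝ} {I : Set ℝ}
    (h : IsGeodesicOn g γ I)
    (hI : IsOpen I) {s : ℝ} (hs : s ∈ I) :
    HasDerivAt γ (deriv γ s) s ∧ HasDerivAt (deriv γ) (deriv (deriv γ) s) s := by
  have h2 : ContDiffOn ℝ (1 + 1) γ I := by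
    rw [one_add_one_eq_two]; exact h.1
  have h1 := ((contDiffOn_succ_iff_deriv_of_isOpen hI).1 h2)
  exact ⟨(h1.1.differentiableAt (hI.mem_nhds hs)).hasDerivAt,
    (((h1.2.2).differentiableOn one_ne_zero).differentiableAt (hI.mem_nhds hs)).hasDerivAt⟩

end GeodesicEquation

/-! ### The geodesic equation of a gyratonic pp-wave -/

section Gyraton

variable {n : ℕ} {H : EuclideanSpace ℝ (Fin n) → ℝ → ℝ}
  {a : EuclideanSpace ℝ (Fin n) → ℝ → EuclideanSpace ℝ (Fin n)}

open Function (uncurry)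
open scoped RealInnerProductSpace

theorem inner_spatialPart (A : EuclideanSpace ℝ (Fin n)) (v : Fin n ⊕ Fin 2 → ℝ) :
    ⟪A, spatialPart v⟫ = ∑ i, A i * v (Sum.inl i) := by
  simp [PiLp.inner_apply, spatialPart, mul_comm]

theorem gyratonMetric_mulVec_inl (p w : Fin n ⊕ Fin 2 → ℝ)
    (i : Fin n) : (gyratonMetric H a p).mulVec w (Sum.inl i)
      = w (Sum.inl i) + a (spatialPart p) (p (Sum.inr 0)) i * w (Sum.inr 0) := by
  simp [gyratonMetric, Matrix.mulVec, dotProduct, Matrix.one_apply]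

theorem gyratonMetric_mulVec_u (p w : Fin n ⊕ Fin 2 → ℝ) :
    (gyratonMetric H a p).mulVec w (Sum.inr 0)
      = ⟪a (spatialPart p) (p (Sum.inr 0)), spatialPart w⟫
        + H (spatialPart p) (p (Sum.inr 0)) * w (Sum.inr 0) - w (Sum.inr 1) := by
  simp [gyratonMetric, Matrix.mulVec, dotProduct, spatialPart, PiLp.inner_apply, mul_comm]
  ring

theorem gyratonMetric_mulVec_r (p w : Fin n ⊕ Fin 2 → ℝ) :
    (gyratonMetric H a p).mulVec w (Sum.inr 1) = - w (Sum.inr 0) := by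
  simp [gyratonMetric, Matrix.mulVec, dotProduct]

theorem isUnit_gyratonMetric (H : EuclideanSpace ℝ (Fin n) → ℝ → ℝ)
    (a : EuclideanSpace ℝ (Fin n) → ℝ → EuclideanSpace ℝ (Fin n)) (p : Fin n ⊕ Fin 2 → ℝ) :
    IsUnit (gyratonMetric H a p) := by
  rw [← Matrix.mulVec_injective_iff_isUnit]
  refine (injective_iff_map_eq_zero (gyratonMetric H a p).mulVecLin).2 fun w hw => ?_
  rw [Matrix.mulVecLin_apply] at hw
  have hu : w (Sum.inr 0) = 0 := by
    have := congrFun hw (Sum.inr 1)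
    rw [gyratonMetric_mulVec_r] at this
    simpa using this
  have hx : ∀ i, w (Sum.inl i) = 0 := fun i => by
    have := congrFun hw (Sum.inl i)
    rw [gyratonMetric_mulVec_inl, hu] at this
    simpa using this
  have hr : w (Sum.inr 1) = 0 := by
    have := congrFun hw (Sum.inr 0)
    rw [gyratonMetric_mulVec_u, hu, show spatialPart w = 0 by ext i; exact hx i] at this
    simpa using this
  ext μ
  match μ with
  | Sum.inl i => exact hx i
  | Sum.inr 0 => exact hu
  | Sum.inr 1 => exact hr

/-- The projection `(x, u, r) ↦ (x, u)`, as a continuous linear map. The components of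
the metric factor through it. -/
noncomputable def spatialTimeProj : (Fin n ⊕ Fin 2 → ℝ) →L[ℝ] EuclideanSpace ℝ (Fin n) × ℝ :=
  ((EuclideanSpace.equiv (Fin n) ℝ).symm.toContinuousLinearMap.comp
    (ContinuousLinearMap.pi fun i => ContinuousLinearMap.proj (Sum.inl i))).prod
    (ContinuousLinearMap.proj (Sum.inr 0))

theorem spatialTimeProj_apply (p : Fin n ⊕ Fin 2 → ℝ) :
    spatialTimeProj p = (spatialPart p, p (Sum.inr 0)) := rfl

theorem spatialTimeProj_single_inl (i : Fin n) :
    spatialTimeProj (Pi.single (Sum.inl i) 1) = (EuclideanSpace.single i (1 : ℝ), (0 : ℝ)) := by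
  rw [spatialTimeProj_apply]
  ext j <;> simp [spatialPart, Pi.single_apply]

theorem spatialTimeProj_single_u :
    spatialTimeProj (Pi.single (Sum.inr 0) 1) = ((0 : EuclideanSpace ℝ (Fin n)), (1 : ℝ)) := by
  rw [spatialTimeProj_apply]
  ext j <;> simp [spatialPart]

theorem spatialTimeProj_single_r :
    spatialTimeProj (Pi.single (Sum.inr 1) 1) = ((0 : EuclideanSpace ℝ (Fin n)), (0 : ℝ)) := by
  rw [spatialTimeProj_apply]
  ext j <;> simp [spatialPart]

theorem fderiv_comp_spatialTimeProj {f : EuclideanSpace ℝ (Fin n) × ℝ → ℝ} (hf : Differentiable ℝ f)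
    (p v : Fin n ⊕ Fin 2 → ℝ) :
    fderiv ℝ (fun q : Fin n ⊕ Fin 2 → ℝ => f (spatialPart q, q (Sum.inr 0))) p v
      = fderiv ℝ f (spatialPart p, p (Sum.inr 0)) (spatialTimeProj v) := by
  have := (hf _).hasFDerivAt.comp p (spatialTimeProj (n := n)).hasFDerivAt
  exact congrArg (· v) this.fderiv

theorem fderiv_coord_comp {f : EuclideanSpace ℝ (Fin n) × ℝ → EuclideanSpace ℝ (Fin n)}
    (hf : Differentiable ℝ f) (q w : EuclideanSpace ℝ (Fin n) × ℝ) (i : Fin n) :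
    fderiv ℝ (fun q => f q i) q w = fderiv ℝ f q w i := by
  have := (EuclideanSpace.proj (𝕜 := ℝ) i).hasFDerivAt.comp q (hf q).hasFDerivAt
  exact congrArg (· w) this.fderiv

theorem fderiv_coord_comp_spatialTimeProj
    (ha : Differentiable ℝ (uncurry a)) (p v : Fin n ⊕ Fin 2 → ℝ) (i : Fin n) :
    fderiv ℝ (fun q : Fin n ⊕ Fin 2 → ℝ => a (spatialPart q) (q (Sum.inr 0)) i) p v
      = fderiv ℝ (uncurry a) (spatialPart p, p (Sum.inr 0))
          (spatialTimeProj v) i := by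
  rw [← fderiv_coord_comp ha]
  exact fderiv_comp_spatialTimeProj (f := fun q => a q.1 q.2 i) (differentiable_euclidean.1 ha i)
    p v

theorem fderiv_gyratonMetric_inl_inl (p v : Fin n ⊕ Fin 2 → ℝ) (i j : Fin n) :
    fderiv ℝ (fun q => gyratonMetric H a q (Sum.inl i) (Sum.inl j)) p v = 0 := by
  simp [gyratonMetric]

theorem fderiv_gyratonMetric_inl_u (ha : Differentiable ℝ (uncurry a))
    (p v : Fin n ⊕ Fin 2 → ℝ) (i : Fin n) :
    fderiv ℝ (fun q => gyratonMetric H a q (Sum.inl i) (Sum.inr 0)) p v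
      = fderiv ℝ (uncurry a) (spatialPart p, p (Sum.inr 0))
          (spatialTimeProj v) i := by
  simpa [gyratonMetric] using fderiv_coord_comp_spatialTimeProj ha p v i

theorem fderiv_gyratonMetric_u_inl (ha : Differentiable ℝ (uncurry a))
    (p v : Fin n ⊕ Fin 2 → ℝ) (i : Fin n) :
    fderiv ℝ (fun q => gyratonMetric H a q (Sum.inr 0) (Sum.inl i)) p v
      = fderiv ℝ (uncurry a) (spatialPart p, p (Sum.inr 0))
          (spatialTimeProj v) i := by
  simpa [gyratonMetric] using fderiv_coord_comp_spatialTimeProj ha p v i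

theorem fderiv_gyratonMetric_u_u (hH : Differentiable ℝ (uncurry H))
    (p v : Fin n ⊕ Fin 2 → ℝ) :
    fderiv ℝ (fun q => gyratonMetric H a q (Sum.inr 0) (Sum.inr 0)) p v
      = fderiv ℝ (uncurry H) (spatialPart p, p (Sum.inr 0))
          (spatialTimeProj v) := by
  simpa [gyratonMetric] using fderiv_comp_spatialTimeProj hH p v

theorem fderiv_gyratonMetric_r_left (p v : Fin n ⊕ Fin 2 → ℝ) (ρ : Fin n ⊕ Fin 2) :
    fderiv ℝ (fun q => gyratonMetric H a q (Sum.inr 1) ρ) p v = 0 := by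
  match ρ with
  | Sum.inl i => simp [gyratonMetric]
  | Sum.inr 0 => simp [gyratonMetric]
  | Sum.inr 1 => simp [gyratonMetric]

theorem fderiv_gyratonMetric_r_right (p v : Fin n ⊕ Fin 2 → ℝ) (ρ : Fin n ⊕ Fin 2) :
    fderiv ℝ (fun q => gyratonMetric H a q ρ (Sum.inr 1)) p v = 0 := by
  match ρ with
  | Sum.inl i => simp [gyratonMetric]
  | Sum.inr 0 => simp [gyratonMetric]
  | Sum.inr 1 => simp [gyratonMetric]

/-- The derivative along the coordinate `σ` of the quadratic form `g(v, v)`, at fixed `v`. -/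
theorem sum_partialDeriv_gyratonMetric
    (hH : Differentiable ℝ (uncurry H))
    (ha : Differentiable ℝ (uncurry a))
    (p v : Fin n ⊕ Fin 2 → ℝ) (σ : Fin n ⊕ Fin 2) :
    ∑ ν, ∑ ρ, partialDeriv σ (fun q => gyratonMetric H a q ν ρ) p * v ν * v ρ
      = fderiv ℝ (uncurry H) (spatialPart p, p (Sum.inr 0))
          (spatialTimeProj (Pi.single σ 1)) * v (Sum.inr 0) ^ 2
        + 2 * v (Sum.inr 0) * ⟪fderiv ℝ (uncurry a)
          (spatialPart p, p (Sum.inr 0)) (spatialTimeProj (Pi.single σ 1)), spatialPart v⟫ := by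
  have h1 : ∀ A : EuclideanSpace ℝ (Fin n), ∑ i, A i * v (Sum.inl i) * v (Sum.inr 0)
      = ⟪A, spatialPart v⟫ * v (Sum.inr 0) := fun A => by
    rw [inner_spatialPart, Finset.sum_mul]
  have h2 : ∀ A : EuclideanSpace ℝ (Fin n), ∑ i, A i * v (Sum.inr 0) * v (Sum.inl i)
      = ⟪A, spatialPart v⟫ * v (Sum.inr 0) := fun A => by
    rw [← h1]
    exact Finset.sum_congr rfl fun i _ => by ring
  simp only [partialDeriv, Fintype.sum_sum_type, Fin.sum_univ_two, fderiv_gyratonMetric_inl_inl,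
    fderiv_gyratonMetric_inl_u ha, fderiv_gyratonMetric_u_inl ha, fderiv_gyratonMetric_u_u hH,
    fderiv_gyratonMetric_r_left, fderiv_gyratonMetric_r_right, zero_mul, Finset.sum_const_zero,
    zero_add, add_zero, h1, h2]
  ring

theorem loweredGeodesicForm_gyratonMetric_inl
    (hH : Differentiable ℝ (uncurry H))
    (ha : Differentiable ℝ (uncurry a))
    (p v : Fin n ⊕ Fin 2 → ℝ) (i : Fin n) :
    loweredGeodesicForm (gyratonMetric H a) p v (Sum.inl i)
      = fderiv ℝ (uncurry a) (spatialPart p, p (Sum.inr 0))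
          (spatialPart v, v (Sum.inr 0)) i * v (Sum.inr 0)
        - (1 / 2) * fderiv ℝ (uncurry H) (spatialPart p, p (Sum.inr 0))
          (EuclideanSpace.single i 1, 0) * v (Sum.inr 0) ^ 2
        - v (Sum.inr 0) * ⟪fderiv ℝ (uncurry a)
          (spatialPart p, p (Sum.inr 0)) (EuclideanSpace.single i 1, 0), spatialPart v⟫ := by
  rw [loweredGeodesicForm, sum_partialDeriv_gyratonMetric hH ha, spatialTimeProj_single_inl]
  simp only [Fintype.sum_sum_type, Fin.sum_univ_two, fderiv_gyratonMetric_inl_inl,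
    fderiv_gyratonMetric_inl_u ha, fderiv_gyratonMetric_r_right, spatialTimeProj_apply,
    zero_mul, Finset.sum_const_zero]
  ring

theorem loweredGeodesicForm_gyratonMetric_u
    (hH : Differentiable ℝ (uncurry H))
    (ha : Differentiable ℝ (uncurry a))
    (p v : Fin n ⊕ Fin 2 → ℝ) :
    loweredGeodesicForm (gyratonMetric H a) p v (Sum.inr 0)
      = ⟪fderiv ℝ (uncurry a) (spatialPart p, p (Sum.inr 0))
          (spatialPart v, v (Sum.inr 0)), spatialPart v⟫
        + fderiv ℝ (uncurry H) (spatialPart p, p (Sum.inr 0))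
          (spatialPart v, v (Sum.inr 0)) * v (Sum.inr 0)
        - (1 / 2) * fderiv ℝ (uncurry H) (spatialPart p, p (Sum.inr 0))
          (0, 1) * v (Sum.inr 0) ^ 2
        - v (Sum.inr 0) * ⟪fderiv ℝ (uncurry a)
          (spatialPart p, p (Sum.inr 0)) (0, 1), spatialPart v⟫ := by
  rw [loweredGeodesicForm, sum_partialDeriv_gyratonMetric hH ha, spatialTimeProj_single_u]
  simp only [Fintype.sum_sum_type, Fin.sum_univ_two, fderiv_gyratonMetric_u_inl ha,
    fderiv_gyratonMetric_u_u hH, fderiv_gyratonMetric_r_right, spatialTimeProj_apply,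
    zero_mul, inner_spatialPart]
  ring

theorem loweredGeodesicForm_gyratonMetric_r
    (hH : Differentiable ℝ (uncurry H))
    (ha : Differentiable ℝ (uncurry a))
    (p v : Fin n ⊕ Fin 2 → ℝ) :
    loweredGeodesicForm (gyratonMetric H a) p v (Sum.inr 1) = 0 := by
  rw [loweredGeodesicForm, sum_partialDeriv_gyratonMetric hH ha, spatialTimeProj_single_r,
    ← Prod.zero_eq_mk]
  simp [fderiv_gyratonMetric_r_left]

/-- The spatial acceleration `x'' = G(u, x, v)` of a geodesic with spatial velocity `v = x'` and
`u' = α`: `G_i = α ⟪∂_i a, v⟫ + ½ α² ∂_i H - α (Da (v, α))_i`. -/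
noncomputable def spatialForce (H : EuclideanSpace ℝ (Fin n) → ℝ → ℝ)
    (a : EuclideanSpace ℝ (Fin n) → ℝ → EuclideanSpace ℝ (Fin n)) (α u : ℝ)
    (x v : EuclideanSpace ℝ (Fin n)) : EuclideanSpace ℝ (Fin n) :=
  WithLp.toLp 2 fun i =>
    α * ⟪fderiv ℝ (uncurry a) (x, u) (EuclideanSpace.single i 1, 0), v⟫
      + (1 / 2) * α ^ 2 * fderiv ℝ (uncurry H) (x, u)
          (EuclideanSpace.single i 1, 0)
      - α * fderiv ℝ (uncurry a) (x, u) (v, α) i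

/-- The acceleration `r''` of a geodesic with spatial velocity `v = x'` and `u' = α`. -/
noncomputable def transverseForce (H : EuclideanSpace ℝ (Fin n) → ℝ → ℝ)
    (a : EuclideanSpace ℝ (Fin n) → ℝ → EuclideanSpace ℝ (Fin n)) (α u : ℝ)
    (x v : EuclideanSpace ℝ (Fin n)) : ℝ :=
  ⟪a x u, spatialForce H a α u x v⟫
    + ⟪fderiv ℝ (uncurry a) (x, u) (v, α), v⟫
    + α * fderiv ℝ (uncurry H) (x, u) (v, α)
    - (1 / 2) * α ^ 2 * fderiv ℝ (uncurry H) (x, u) (0, 1)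
    - α * ⟪fderiv ℝ (uncurry a) (x, u) (0, 1), v⟫

/-- The geodesic equation at the point `p` with velocity `v` and acceleration `w` decouples:
`u'' = 0`, while `x''` and `r''` are given by forces that depend on `u`, `u'`, `x` and `x'` only. -/
theorem gyraton_geodesicEquation_iff
    (hH : Differentiable ℝ (uncurry H))
    (ha : Differentiable ℝ (uncurry a))
    (p v w : Fin n ⊕ Fin 2 → ℝ) :
    (∀ μ, w μ + ∑ ν, ∑ ρ, christoffel (gyratonMetric H a) p μ ν ρ * v ν * v ρ = 0) ↔
      w (Sum.inr 0) = 0 ∧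
      spatialPart w = spatialForce H a (v (Sum.inr 0)) (p (Sum.inr 0))
        (spatialPart p) (spatialPart v) ∧
      w (Sum.inr 1) = transverseForce H a (v (Sum.inr 0)) (p (Sum.inr 0))
        (spatialPart p) (spatialPart v) := by
  rw [geodesicEquation_iff_lowered (isUnit_gyratonMetric H a p), Sum.forall, Fin.forall_fin_two,
    gyratonMetric_mulVec_u, gyratonMetric_mulVec_r, loweredGeodesicForm_gyratonMetric_u hH ha,
    loweredGeodesicForm_gyratonMetric_r hH ha]
  simp only [gyratonMetric_mulVec_inl, loweredGeodesicForm_gyratonMetric_inl hH ha]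
  constructor
  · rintro ⟨h1, h2, h3⟩
    have h0 : w (Sum.inr 0) = 0 := by linarith
    have h4 : spatialPart w = spatialForce H a (v (Sum.inr 0)) (p (Sum.inr 0))
        (spatialPart p) (spatialPart v) := by
      ext i
      have := h1 i
      rw [h0] at this
      simp only [spatialForce, spatialPart] at this ⊢
      linarith
    refine ⟨h0, h4, ?_⟩
    rw [h4, h0] at h2
    rw [transverseForce]
    linarith
  · rintro ⟨h0, h4, h5⟩
    refine ⟨fun i => ?_, ?_, by simp [h0]⟩
    · have : w (Sum.inl i) = _ := congrArg (fun z : EuclideanSpace ℝ (Fin n) => z i) h4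
      rw [h0, this]
      simp only [spatialForce]
      ring
    · rw [h5, h4, h0, transverseForce]
      ring

/-! ### Estimates and regularity of the forces -/

theorem sum_mul_apply_single (ℓ : EuclideanSpace ℝ (Fin n) →L[ℝ] ℝ)
    (w : EuclideanSpace ℝ (Fin n)) : ∑ i, w i * ℓ (EuclideanSpace.single i 1) = ℓ w := by
  conv_rhs => rw [← (EuclideanSpace.basisFun (Fin n) ℝ).sum_repr w]
  simp [map_sum]

theorem inner_spatialForce (α u : ℝ) (x v w : EuclideanSpace ℝ (Fin n)) :
    ⟪w, spatialForce H a α u x v⟫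
      = α * ⟪fderiv ℝ (uncurry a) (x, u) (w, 0), v⟫
        + (1 / 2) * α ^ 2 * fderiv ℝ (uncurry H) (x, u) (w, 0)
        - α * ⟪fderiv ℝ (uncurry a) (x, u) (v, α), w⟫ := by
  have h1 := sum_mul_apply_single ((fderiv ℝ (uncurry H) (x, u)).comp
    (ContinuousLinearMap.inl ℝ (EuclideanSpace ℝ (Fin n)) ℝ)) w
  have h2 := sum_mul_apply_single ((innerSL ℝ v).comp ((fderiv ℝ (uncurry a) (x, u)).comp
    (ContinuousLinearMap.inl ℝ (EuclideanSpace ℝ (Fin n)) ℝ))) w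
  simp only [ContinuousLinearMap.comp_apply, ContinuousLinearMap.inl_apply, innerSL_apply_apply]
    at h1 h2
  simp only [real_inner_comm _ v] at h2
  rw [← h1, ← h2, PiLp.inner_apply, PiLp.inner_apply, Finset.mul_sum, Finset.mul_sum,
    Finset.mul_sum, ← Finset.sum_add_distrib, ← Finset.sum_sub_distrib]
  refine Finset.sum_congr rfl fun i _ => ?_
  simp only [spatialForce, RCLike.inner_apply, conj_trivial]
  ring

/-- The power of the spatial force. The contributions of the spatial derivatives of `a` cancel,
since they enter the force through a skew-symmetric operator acting on the velocity. -/
theorem inner_self_spatialForce (α u : ℝ) (x v : EuclideanSpace ℝ (Fin n)) :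
    ⟪v, spatialForce H a α u x v⟫
      = (1 / 2) * α ^ 2 * fderiv ℝ (uncurry H) (x, u) (v, 0)
        - α ^ 2 * ⟪fderiv ℝ (uncurry a) (x, u) (0, 1), v⟫ := by
  have h : fderiv ℝ (uncurry a) (x, u) (v, α) = fderiv ℝ (uncurry a) (x, u) (v, 0)
      + α • fderiv ℝ (uncurry a) (x, u) (0, 1) := by
    rw [← map_smul, ← map_add]
    simp
  rw [inner_spatialForce, h, inner_add_left, real_inner_smul_left]
  ring

theorem inner_gradient_slice (hH : Differentiable ℝ (uncurry H)) (u : ℝ)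
    (x v : EuclideanSpace ℝ (Fin n)) :
    ⟪gradient (fun y => H y u) x, v⟫ = fderiv ℝ (uncurry H) (x, u) (v, 0) := by
  have h : HasFDerivAt (fun y => H y u) ((fderiv ℝ (uncurry H) (x, u)).comp
      (ContinuousLinearMap.inl ℝ (EuclideanSpace ℝ (Fin n)) ℝ)) x :=
    (hH (x, u)).hasFDerivAt.comp (f := fun y => (y, u)) x (hasFDerivAt_prodMk_left x u)
  rw [gradient, h.fderiv, InnerProductSpace.toDual_symm_apply]
  simp

theorem deriv_slice (ha : Differentiable ℝ (uncurry a)) (u : ℝ) (x : EuclideanSpace ℝ (Fin n)) :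
    deriv (fun s => a x s) u = fderiv ℝ (uncurry a) (x, u) (0, 1) := by
  have h := (ha (x, u)).hasFDerivAt.comp_hasDerivAt u
    ((hasDerivAt_const u x).prodMk (hasDerivAt_id u))
  exact h.deriv

theorem GrowsAtMostLinearly.exists_norm_le
    {X : EuclideanSpace ℝ (Fin n) → ℝ → EuclideanSpace ℝ (Fin n)} (hX : GrowsAtMostLinearly X)
    {T : ℝ} (hT : 0 < T) :
    ∃ B, 0 ≤ B ∧ ∀ x, ∀ s ∈ Set.Icc (-T) T, ‖X x s‖ ≤ B * (1 + ‖x‖) := by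
  obtain ⟨x₀, A, C, hA, hC, h⟩ := hX T hT
  refine ⟨A + A * ‖x₀‖ + C, by positivity, fun x s hs => (h x s hs).trans ?_⟩
  have h1 : A * dist x x₀ ≤ A * (‖x‖ + ‖x₀‖) := by
    gcongr
    rw [dist_eq_norm]
    exact norm_sub_le x x₀
  have h2 : 0 ≤ (A * ‖x₀‖ + C) * ‖x‖ := by positivity
  nlinarith

theorem exists_abs_inner_spatialForce_le (hH : Differentiable ℝ (uncurry H))
    (ha : Differentiable ℝ (uncurry a))
    (hHx : GrowsAtMostLinearly (fun x u => gradient (fun y => H y u) x))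
    (hau : GrowsAtMostLinearly (fun x u => deriv (fun s => a x s) u)) (α : ℝ) {T : ℝ}
    (hT : 0 < T) :
    ∃ K, ∀ u ∈ Set.Icc (-T) T, ∀ x v,
      |⟪v, spatialForce H a α u x v⟫| ≤ K * (1 + ‖x‖ ^ 2 + ‖v‖ ^ 2) := by
  obtain ⟨B, hB, hHB⟩ := hHx.exists_norm_le hT
  obtain ⟨B', hB', haB⟩ := hau.exists_norm_le hT
  refine ⟨α ^ 2 * (B + B'), fun u hu x v => ?_⟩
  rw [inner_self_spatialForce, ← inner_gradient_slice hH, ← deriv_slice ha]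
  have h1 : |⟪gradient (fun y => H y u) x, v⟫| ≤ B * (1 + ‖x‖) * ‖v‖ :=
    (abs_real_inner_le_norm _ _).trans (by gcongr; exact hHB x u hu)
  have h2 : |⟪deriv (fun s => a x s) u, v⟫| ≤ B' * (1 + ‖x‖) * ‖v‖ :=
    (abs_real_inner_le_norm _ _).trans (by gcongr; exact haB x u hu)
  have h3 : (1 + ‖x‖) * ‖v‖ ≤ 1 + ‖x‖ ^ 2 + ‖v‖ ^ 2 := by
    nlinarith [sq_nonneg (1 + ‖x‖ - ‖v‖), sq_nonneg (1 - ‖x‖), sq_nonneg ‖v‖]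
  calc _ ≤ α ^ 2 * |⟪gradient (fun y => H y u) x, v⟫|
        + α ^ 2 * |⟪deriv (fun s => a x s) u, v⟫| := by
        refine (abs_sub _ _).trans ?_
        rw [abs_mul, abs_mul (α ^ 2), abs_of_nonneg (a := 1 / 2 * α ^ 2) (by positivity),
          abs_of_nonneg (sq_nonneg α)]
        have := mul_nonneg (sq_nonneg α) (abs_nonneg ⟪gradient (fun y => H y u) x, v⟫)
        linarith
    _ ≤ α ^ 2 * (B * (1 + ‖x‖) * ‖v‖) + α ^ 2 * (B' * (1 + ‖x‖) * ‖v‖) := by gcongr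
    _ = α ^ 2 * (B + B') * ((1 + ‖x‖) * ‖v‖) := by ring
    _ ≤ _ := by gcongr

theorem contDiff_spatialForce (hH : ContDiff ℝ ∞ (uncurry H)) (ha : ContDiff ℝ ∞ (uncurry a))
    (α : ℝ) : ContDiff ℝ 1 fun q : ℝ × EuclideanSpace ℝ (Fin n) × EuclideanSpace ℝ (Fin n) =>
      spatialForce H a α q.1 q.2.1 q.2.2 := by
  have hH' : ContDiff ℝ 1 (fderiv ℝ (uncurry H)) := hH.fderiv_right (by norm_cast)
  have ha' : ContDiff ℝ 1 (fderiv ℝ (uncurry a)) := ha.fderiv_right (by norm_cast)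
  refine contDiff_euclidean.2 fun i => ?_
  have h : ContDiff ℝ 1 fun q : ℝ × EuclideanSpace ℝ (Fin n) × EuclideanSpace ℝ (Fin n) =>
      fderiv ℝ (uncurry a) (q.2.1, q.1) (q.2.2, α) := by fun_prop
  have h' := contDiff_euclidean.1 h i
  simp only [spatialForce]
  refine (ContDiff.add ?_ ?_).sub (contDiff_const.mul h')
  · exact contDiff_const.mul (ContDiff.inner ℝ (by fun_prop) (by fun_prop))
  · fun_prop

theorem contDiff_transverseForce (hH : ContDiff ℝ ∞ (uncurry H))
    (ha : ContDiff ℝ ∞ (uncurry a)) (α : ℝ) :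
    ContDiff ℝ 1 fun q : ℝ × EuclideanSpace ℝ (Fin n) × EuclideanSpace ℝ (Fin n) =>
      transverseForce H a α q.1 q.2.1 q.2.2 := by
  have hH' : ContDiff ℝ 1 (fderiv ℝ (uncurry H)) := hH.fderiv_right (by norm_cast)
  have ha' : ContDiff ℝ 1 (fderiv ℝ (uncurry a)) := ha.fderiv_right (by norm_cast)
  have ha1 : ContDiff ℝ 1 (uncurry a) := ha.of_le (by norm_cast)
  have hG := contDiff_spatialForce hH ha α
  simp only [transverseForce]
  have h0 : ContDiff ℝ 1 fun q : ℝ × EuclideanSpace ℝ (Fin n) × EuclideanSpace ℝ (Fin n) =>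
      a q.2.1 q.1 := ha1.comp (contDiff_snd.fst.prodMk contDiff_fst)
  refine ContDiff.sub (ContDiff.sub (ContDiff.add (ContDiff.add ?_ ?_) ?_) ?_) ?_
  · exact h0.inner ℝ hG
  · exact ContDiff.inner ℝ (by fun_prop) (by fun_prop)
  · fun_prop
  · fun_prop
  · exact contDiff_const.mul (ContDiff.inner ℝ (by fun_prop) (by fun_prop))

-- Unification would otherwise unfold both forces when it compares compositions with them.
attribute [irreducible] spatialForce transverseForce

theorem contDiff_spatialForce_comp (hH : ContDiff ℝ ∞ (uncurry H))
    (ha : ContDiff ℝ ∞ (uncurry a)) (α : ℝ) {u : ℝ → ℝ} (hu : ContDiff ℝ 1 u) :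
    ContDiff ℝ 1 fun q : ℝ × EuclideanSpace ℝ (Fin n) × EuclideanSpace ℝ (Fin n) =>
      spatialForce H a α (u q.1) q.2.1 q.2.2 := by
  have h : ContDiff ℝ 1 fun q : ℝ × EuclideanSpace ℝ (Fin n) × EuclideanSpace ℝ (Fin n) =>
      (u q.1, q.2) := by fun_prop
  exact (contDiff_spatialForce hH ha α).comp h

/-! ### Geodesics in coordinates and their extension -/

theorem HasDerivAt.spatialPart {γ : ℝ → Fin n ⊕ Fin 2 → ℝ} {γ' : Fin n ⊕ Fin 2 → ℝ} {s : ℝ}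
    (h : HasDerivAt γ γ' s) : HasDerivAt (fun t => spatialPart (γ t)) (spatialPart γ') s :=
  (spatialTimeProj (n := n)).hasFDerivAt.comp_hasDerivAt s h |>.fst

/-- The point of `M = ℝⁿ × ℝ²` with coordinates `(x, u, r)`. -/
noncomputable def pointOfCoords (x : EuclideanSpace ℝ (Fin n)) (u r : ℝ) : Fin n ⊕ Fin 2 → ℝ :=
  Sum.elim (fun i => x i) ![u, r]

theorem hasDerivAt_pointOfCoords {x : ℝ → EuclideanSpace ℝ (Fin n)} {u r : ℝ → ℝ}
    {x' : EuclideanSpace ℝ (Fin n)} {u' r' t : ℝ} (hx : HasDerivAt x x' t)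
    (hu : HasDerivAt u u' t) (hr : HasDerivAt r r' t) :
    HasDerivAt (fun t => pointOfCoords (x t) (u t) (r t)) (pointOfCoords x' u' r') t := by
  rw [hasDerivAt_pi]
  intro μ
  match μ with
  | Sum.inl i => exact (EuclideanSpace.proj (𝕜 := ℝ) i).hasFDerivAt.comp_hasDerivAt t hx
  | Sum.inr 0 => exact hu
  | Sum.inr 1 => exact hr

theorem isGeodesicOn_gyratonMetric_of_hasDerivAt (hH : ContDiff ℝ ∞ (uncurry H))
    (ha : ContDiff ℝ ∞ (uncurry a)) {α : ℝ} {x v : ℝ → EuclideanSpace ℝ (Fin n)} {u r w : ℝ → ℝ}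
    (hu : ∀ t, HasDerivAt u α t) (hx : ∀ t, HasDerivAt x (v t) t)
    (hv : ∀ t, HasDerivAt v (spatialForce H a α (u t) (x t) (v t)) t)
    (hr : ∀ t, HasDerivAt r (w t) t)
    (hw : ∀ t, HasDerivAt w (transverseForce H a α (u t) (x t) (v t)) t) :
    IsGeodesicOn (gyratonMetric H a) (fun t => pointOfCoords (x t) (u t) (r t)) Set.univ := by
  have h1 := fun t => hasDerivAt_pointOfCoords (hx t) (hu t) (hr t)
  have h2 := fun t => hasDerivAt_pointOfCoords (hv t) (hasDerivAt_const t α) (hw t)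
  have hcv : Continuous v := continuous_iff_continuousAt.2 fun t => (hv t).continuousAt
  have hcx : Continuous x := continuous_iff_continuousAt.2 fun t => (hx t).continuousAt
  have hcu : Continuous u := continuous_iff_continuousAt.2 fun t => (hu t).continuousAt
  have hc : Continuous fun t => (u t, x t, v t) := by fun_prop
  have hG := (contDiff_spatialForce hH ha α).continuous.comp hc
  have hR := (contDiff_transverseForce hH ha α).continuous.comp hc
  have hcont : Continuous fun t => pointOfCoords (spatialForce H a α (u t) (x t) (v t)) 0
      (transverseForce H a α (u t) (x t) (v t)) := by
    refine continuous_pi fun μ => ?_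
    match μ with
    | Sum.inl i => exact (EuclideanSpace.proj (𝕜 := ℝ) i).continuous.comp hG
    | Sum.inr 0 => exact continuous_const
    | Sum.inr 1 => exact hR
  have hd1 : deriv (fun t => pointOfCoords (x t) (u t) (r t))
      = fun t => pointOfCoords (v t) α (w t) := funext fun t => (h1 t).deriv
  refine ⟨contDiffOn_univ.2 ?_, fun s _ => ?_⟩
  · exact contDiff_of_hasDerivAt (n := 1) h1 (contDiff_of_hasDerivAt (n := 0) h2
      (contDiff_zero.2 hcont))
  · rw [hd1, (h2 s).deriv, gyraton_geodesicEquation_iff (hH.differentiable (by simp))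
      (ha.differentiable (by simp))]
    exact ⟨rfl, rfl, rfl⟩

/-- Global solutions, with arbitrary initial data, of the equations to which the geodesic equation
reduces. -/
theorem exists_gyraton_geodesic_coords (hH : ContDiff ℝ ∞ (uncurry H))
    (ha : ContDiff ℝ ∞ (uncurry a))
    (hHx : GrowsAtMostLinearly (fun x u => gradient (fun y => H y u) x))
    (hau : GrowsAtMostLinearly (fun x u => deriv (fun s => a x s) u))
    (t₀ α β : ℝ) (x₀ v₀ : EuclideanSpace ℝ (Fin n)) (r₀ w₀ : ℝ) :
    ∃ (u : ℝ → ℝ) (x v : ℝ → EuclideanSpace ℝ (Fin n)) (r w : ℝ → ℝ),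
      (u t₀ = β ∧ x t₀ = x₀ ∧ v t₀ = v₀ ∧ r t₀ = r₀ ∧ w t₀ = w₀) ∧
      (∀ t, HasDerivAt u α t) ∧ (∀ t, HasDerivAt x (v t) t) ∧
      (∀ t, HasDerivAt v (spatialForce H a α (u t) (x t) (v t)) t) ∧
      (∀ t, HasDerivAt r (w t) t) ∧
      (∀ t, HasDerivAt w (transverseForce H a α (u t) (x t) (v t)) t) := by
  let u : ℝ → ℝ := fun t => β + α * (t - t₀)
  have hu : ∀ t, HasDerivAt u α t := fun t => by
    have := (((hasDerivAt_id t).sub_const t₀).const_mul α).const_add β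
    rwa [mul_one] at this
  have huC : ContDiff ℝ 1 u := by fun_prop
  have hG : ContDiff ℝ 1 fun q : ℝ × EuclideanSpace ℝ (Fin n) × EuclideanSpace ℝ (Fin n) =>
      spatialForce H a α (u q.1) q.2.1 q.2.2 :=
    contDiff_spatialForce_comp hH ha α huC
  obtain ⟨x, v, hx0, hv0, hx, hv⟩ := exists_forall_hasDerivAt_second_order
    (G := fun t => spatialForce H a α (u t)) hG t₀ (fun T hT => by
    obtain ⟨K, hK⟩ := exists_abs_inner_spatialForce_le (hH.differentiable (by simp))
      (ha.differentiable (by simp)) hHx hau α (T := |β| + |α| * T + 1) (by positivity)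
    refine ⟨K, fun t ht x v => hK (u t) (abs_le.1 ?_) x v⟩
    calc |β + α * (t - t₀)| ≤ |β| + |α| * |t - t₀| := by
          rw [← abs_mul]; exact abs_add_le _ _
      _ ≤ |β| + |α| * T := by
          gcongr
          rw [abs_le]; constructor <;> linarith [ht.1, ht.2]
      _ ≤ _ := by linarith) x₀ v₀
  have hcv : Continuous v := continuous_iff_continuousAt.2 fun t => (hv t).continuousAt
  have hcx : Continuous x := continuous_iff_continuousAt.2 fun t => (hx t).continuousAt
  have hR : Continuous fun t => transverseForce H a α (u t) (x t) (v t) :=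
    Continuous.comp (g := fun q => transverseForce H a α q.1 q.2.1 q.2.2)
      (f := fun t => (u t, x t, v t)) (contDiff_transverseForce hH ha α).continuous (by fun_prop)
  obtain ⟨w, hw0, hw⟩ := exists_antideriv hR t₀ w₀
  have hwc : Continuous w := continuous_iff_continuousAt.2 fun t => (hw t).continuousAt
  obtain ⟨r, hr0, hr⟩ := exists_antideriv hwc t₀ r₀
  exact ⟨u, x, v, r, w, ⟨by simp [u], hx0, hv0, hr0, hw0⟩, hu, hx, hv, hr, hw⟩

end Gyraton

theorem corollary3p5 (n : ℕ)
    (H : EuclideanSpace ℝ (Fin n) → ℝ → ℝ)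
    (a : EuclideanSpace ℝ (Fin n) → ℝ → EuclideanSpace ℝ (Fin n))
    (hH : ContDiff ℝ ∞ (fun q : EuclideanSpace ℝ (Fin n) × ℝ => H q.1 q.2))
    (ha : ContDiff ℝ ∞ (fun q : EuclideanSpace ℝ (Fin n) × ℝ => a q.1 q.2))
    (hHx : GrowsAtMostLinearly (fun x u => gradient (fun y => H y u) x))
    (hau : GrowsAtMostLinearly (fun x u => deriv (fun s => a x s) u)) :
    GeodesicallyComplete (gyratonMetric H a) := by
  intro I γ hIo hIc hγ
  rcases I.eq_empty_or_nonempty with rfl | ⟨t₀, ht₀⟩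
  -- The empty curve has no initial data; any global geodesic extends it.
  · exact ⟨fun _ => 0, isGeodesicOn_const _ _ _, Set.eqOn_empty _ _⟩
  have hHd : Differentiable ℝ (Function.uncurry H) := hH.differentiable (by simp)
  have had : Differentiable ℝ (Function.uncurry a) := ha.differentiable (by simp)
  have hγ1 := fun t ht => (hγ.hasDerivAt hIo (s := t) ht).1
  have hγ2 := fun t ht => (hγ.hasDerivAt hIo (s := t) ht).2
  have heq := fun t ht => (gyraton_geodesicEquation_iff hHd had _ _ _).1 (hγ.2 t ht)
  obtain ⟨u, x, v, r, w, ⟨hu0, hx0, hv0, hr0, hw0⟩, hu, hx, hv, hr, hw⟩ :=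
    exists_gyraton_geodesic_coords hH ha hHx hau t₀ (deriv γ t₀ (Sum.inr 0)) (γ t₀ (Sum.inr 0))
      (spatialPart (γ t₀)) (spatialPart (deriv γ t₀)) (γ t₀ (Sum.inr 1)) (deriv γ t₀ (Sum.inr 1))
  generalize hα : deriv γ t₀ (Sum.inr 0) = α at *
  have huC : ContDiff ℝ 1 u := contDiff_of_hasDerivAt (n := 0) hu contDiff_const
  -- Along the given geodesic `u` is affine, since its second derivative vanishes.
  obtain ⟨hγu, hγα⟩ : (∀ t ∈ I, γ t (Sum.inr 0) = u t) ∧ ∀ t ∈ I, deriv γ t (Sum.inr 0) = α :=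
    eqOn_of_hasDerivAt_second_order (G := fun _ _ _ => (0 : ℝ))
    contDiff_const hIc (fun t ht => hasDerivAt_pi.1 (hγ1 t ht) (Sum.inr 0))
    (fun t ht => by
      have h := hasDerivAt_pi.1 (hγ2 t ht) (Sum.inr 0)
      rwa [(heq t ht).1] at h)
    (fun t _ => hu t) (fun t _ => hasDerivAt_const t α) ht₀ hu0.symm hα
  have hG : ContDiff ℝ 1 fun q : ℝ × EuclideanSpace ℝ (Fin n) × EuclideanSpace ℝ (Fin n) =>
      spatialForce H a α (u q.1) q.2.1 q.2.2 :=
    contDiff_spatialForce_comp hH ha α huC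
  have hγG : ∀ t ∈ I, HasDerivAt (fun t => spatialPart (deriv γ t))
      (spatialForce H a α (u t) (spatialPart (γ t)) (spatialPart (deriv γ t))) t := by
    intro t ht
    have h := (hγ2 t ht).spatialPart
    rwa [(heq t ht).2.1, hγα t ht, hγu t ht] at h
  obtain ⟨hγx, hγv⟩ : (∀ t ∈ I, spatialPart (γ t) = x t) ∧
      ∀ t ∈ I, spatialPart (deriv γ t) = v t := eqOn_of_hasDerivAt_second_order
    (G := fun t => spatialForce H a α (u t)) hG hIc
    (fun t ht => (hγ1 t ht).spatialPart) hγG (fun t _ => hx t) (fun t _ => hv t) ht₀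
    hx0.symm hv0.symm
  have hγR : ∀ t ∈ I, HasDerivAt (fun t => deriv γ t (Sum.inr 1))
      (transverseForce H a α (u t) (x t) (v t)) t := by
    intro t ht
    have h := hasDerivAt_pi.1 (hγ2 t ht) (Sum.inr 1)
    rwa [(heq t ht).2.2, hγα t ht, hγu t ht, hγx t ht, hγv t ht] at h
  have hcv : Continuous v := continuous_iff_continuousAt.2 fun t => (hv t).continuousAt
  have hxC : ContDiff ℝ 1 x := contDiff_of_hasDerivAt (n := 0) hx (contDiff_zero.2 hcv)
  have hcG : Continuous fun t => spatialForce H a α (u t) (x t) (v t) :=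
    Continuous.comp (g := fun q => spatialForce H a α (u q.1) q.2.1 q.2.2)
      (f := fun t => (t, x t, v t)) hG.continuous (by fun_prop)
  have hvC : ContDiff ℝ 1 v := contDiff_of_hasDerivAt (n := 0) hv (contDiff_zero.2 hcG)
  have hR : ContDiff ℝ 1 fun t => transverseForce H a α (u t) (x t) (v t) :=
    ContDiff.comp (g := fun q => transverseForce H a α q.1 q.2.1 q.2.2)
      (f := fun t => (u t, x t, v t)) (contDiff_transverseForce hH ha α) (by fun_prop)
  obtain ⟨hγr, -⟩ := eqOn_of_hasDerivAt_second_order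
    (G := fun t _ _ => transverseForce H a α (u t) (x t) (v t)) (hR.comp contDiff_fst) hIc
    (fun t ht => hasDerivAt_pi.1 (hγ1 t ht) (Sum.inr 1)) hγR
    (fun t _ => hr t) (fun t _ => hw t) ht₀ hr0.symm hw0.symm
  refine ⟨_, isGeodesicOn_gyratonMetric_of_hasDerivAt hH ha hu hx hv hr hw, fun t ht => ?_⟩
  ext μ
  match μ with
  | Sum.inl i => exact (congrArg (fun z : EuclideanSpace ℝ (Fin n) => z i) (hγx t ht)).symm
  | Sum.inr 0 => exact (hγu t ht).symm
  | Sum.inr 1 => exact (hγr ht).symm
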